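/- Assume the axiom of choice. A semigroup $R$ is \emph{regular} if every $s\in R$ has an inverse, i.e. an element $t\in R$ with $sts=s$ and $tst=t$; it is \emph{inverse} if every element $s$ has exactly one inverse, which is then denoted $s^{*}$. Inverse semigroups $S$ and $T$ are \emph{strongly Morita equivalent} if there is a set $X$ with a left action of $S$ and a right action of $T$ satisfying $(ss')x=s(s'x)$, $x(tt')=(xt)t'$ and $(sx)t=s(xt)$, together with surjective functions $\langle -,-\rangle\colon X\times X\to S$ and $[-,-]\colon X\times X\to T$ such that for all $x,y,z\in X$, $s\in S$, $t\in T$: (M1) $\langle sx,y\rangle=s\langle x,y\rangle$; (M2) $\langle y,x\rangle=\langle x,y\rangle^{*}$; (M3) $\langle x,x\rangle x=x$; (M4) $[x,yt]=[x,y]t$; (M5) $[x,y]=[y,x]^{*}$; (M6) $x[x,x]=x$; (M7) $\langle x,y\rangle z=x[y,z]$. A semigroup $R$ is an \emph{enlargement} of a subsemigroup $A$ if $A=ARA$ and $R=RAR$. It is a \emph{joint enlargement} of semigroups $S$ and $T$ if it is an enlargement of a subsemigroup isomorphic to $S$ and of a subsemigroup isomorphic to $T$. \textbf{Theorem.} Let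 $S$ and $T$ be inverse semigroups. Then $S$ and $T$ are strongly Morita equivalent if and only if there is a regular semigroup that is a joint enlargement of $S$ and $T$. -/

import Mathlib

open scoped Pointwise RightActions

universe u v

namespace SemigroupMorita

/-- `t` is an inverse of `s` in the semigroup `S`. -/
def IsInverseOf {S : Type u} [Semigroup S] (s t : S) : Prop :=
  s * t * s = s ∧ t * s * t = t

/-- A semigroup is (von Neumann) regular if each of its elements has an inverse. -/
def IsRegularSemigroup (S : Type u) [Semigroup S] : Prop :=
  ∀ s : S, ∃ t : S, IsInverseOf s t

/-- A semigroup is inverse if each of its elements has exactly one inverse. -/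
class IsInverseSemigroup (S : Type u) [Semigroup S] : Prop where
  existsUnique_inverse : ∀ s : S, ∃! t : S, IsInverseOf s t

/-- The unique inverse `s*` of an element `s` of an inverse semigroup. -/
noncomputable def inverse {S : Type u} [Semigroup S] [IsInverseSemigroup S] (s : S) : S :=
  (IsInverseSemigroup.existsUnique_inverse s).choose

theorem isInverseOf_inverse {S : Type u} [Semigroup S] [IsInverseSemigroup S] (s : S) :
    IsInverseOf s (inverse s) :=
  (IsInverseSemigroup.existsUnique_inverse s).choose_spec.1

theorem eq_inverse {S : Type u} [Semigroup S] [IsInverseSemigroup S] {s t : S}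
    (h : IsInverseOf s t) : t = inverse s :=
  (IsInverseSemigroup.existsUnique_inverse s).choose_spec.2 t h

/-- An equivalence biset structure on an `(S, T)`-biset `X`. The left action of `S` is written
`s • x`; the right action of `T` is an action of the opposite semigroup, written `x <• t`;
`SMulCommClass` says that `(s • x) <• t = s • (x <• t)`. The maps `left` and `right` are the
pairings `⟨-, -⟩` and `[-, -]`. -/
structure EquivalenceBiset (S : Type u) (T : Type v) (X : Type (max u v))
    [Semigroup S] [IsInverseSemigroup S] [Semigroup T] [IsInverseSemigroup T]
    [SemigroupAction S X] [SemigroupAction Tᵐᵒᵖ X] [SMulCommClass S Tᵐᵒᵖ X] where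
  left : X → X → S
  right : X → X → T
  left_surjective : Function.Surjective fun p : X × X => left p.1 p.2
  right_surjective : Function.Surjective fun p : X × X => right p.1 p.2
  left_smul : ∀ (s : S) (x y : X), left (s • x) y = s * left x y
  left_swap : ∀ x y : X, left y x = inverse (left x y)
  left_self_smul : ∀ x : X, left x x • x = x
  right_smul : ∀ (x y : X) (t : T), right x (y <• t) = right x y * t
  right_swap : ∀ x y : X, right x y = inverse (right y x)
  smul_right_self : ∀ x : X, x <• right x x = x
  left_smul_eq_smul_right : ∀ x y z : X, left x y • z = x <• right y z

/-- Two inverse semigroups are strongly Morita equivalent if they have an equivalence biset. -/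
def StronglyMoritaEquivalent (S : Type u) (T : Type v)
    [Semigroup S] [IsInverseSemigroup S] [Semigroup T] [IsInverseSemigroup T] : Prop :=
  ∃ (X : Type (max u v)) (_ : SemigroupAction S X) (_ : SemigroupAction Tᵐᵒᵖ X)
    (_ : SMulCommClass S Tᵐᵒᵖ X), Nonempty (EquivalenceBiset S T X)

/-- The semigroup `R` is an enlargement of its subsemigroup `A`: `A = ARA` and `R = RAR`. -/
def IsEnlargement {R : Type u} [Semigroup R] (A : Subsemigroup R) : Prop :=
  (A : Set R) = (A : Set R) * Set.univ * (A : Set R) ∧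
    (Set.univ : Set R) = Set.univ * (A : Set R) * Set.univ

/-- `R` is a joint enlargement of `S` and `T`: it is an enlargement of subsemigroups `A` and `B`
that are isomorphic to `S` and `T`. -/
def IsJointEnlargement (R : Type (max u v)) (S : Type u) (T : Type v)
    [Semigroup R] [Semigroup S] [Semigroup T] : Prop :=
  ∃ A B : Subsemigroup R, Nonempty (S ≃* A) ∧ Nonempty (T ≃* B) ∧
    IsEnlargement A ∧ IsEnlargement B

end SemigroupMorita

/-! Inside a joint enlargement `R`, the biset consists of the pairs `(x, x')` of mutually inverse
elements with `x x'` in `S` and `x' x` in `T`. The pairings are `x y'` and `x' y`. Sandwiching (`SRS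
= S`, `TRT = T`) puts them in the right semigroup, and commuting idempotents give the inverse laws.
Surjectivity comes from `R = RTR` (resp. `R = RSR`), which factors each idempotent of one semigroup
through the other.

Conversely, `S`, `X`, a formal opposite of `X`, and `T` are the four corners of a two-object
semigroupoid, associative by the biset axioms and the adjointness of the actions. The product
becomes total by fixing any `x : X` and inserting `x` or its opposite between non-composable
factors. The result is regular, and its diagonal corners are `S` and `T`. -/

namespace SemigroupMorita

/-! ### Idempotents and inverses in an inverse semigroup. -/

section InverseSemigroup

variable {S : Type u} [Semigroup S] [IsInverseSemigroup S]

theorem IsInverseOf.symm {S : Type u} [Semigroup S] {s t : S} (h : IsInverseOf s t) :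
    IsInverseOf t s :=
  ⟨h.2, h.1⟩

theorem mul_inverse_mul (s : S) : s * inverse s * s = s := (isInverseOf_inverse s).1

theorem inverse_mul_inverse (s : S) : inverse s * s * inverse s = inverse s :=
  (isInverseOf_inverse s).2

@[simp]
theorem inverse_inverse (s : S) : inverse (inverse s) = s :=
  (eq_inverse (isInverseOf_inverse s).symm).symm

theorem inverse_eq_self {e : S} (he : e * e = e) : inverse e = e :=
  (eq_inverse ⟨by rw [he, he], by rw [he, he]⟩).symm

/-- The product of two idempotents of an inverse semigroup is idempotent. -/
theorem mul_idempotent {e f : S} (he : e * e = e) (hf : f * f = f) :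
    e * f * (e * f) = e * f := by
  have he' (a : S) : e * (e * a) = e * a := by rw [← mul_assoc, he]
  have hf' (a : S) : f * (f * a) = f * a := by rw [← mul_assoc, hf]
  obtain ⟨h₁, h₂⟩ := isInverseOf_inverse (e * f)
  set x := inverse (e * f) with hx
  simp only [mul_assoc] at h₁ h₂
  have h₂' (a : S) : x * (e * (f * (x * a))) = x * a := by
    have := congrArg (· * a) h₂
    simpa only [mul_assoc] using this
  -- `f x e` is another inverse of `e f`, so uniqueness applies. It makes `x` idempotent, hence its
  -- own inverse, so `e f = x`.
  have h : f * x * e = x := by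
    refine eq_inverse ⟨?_, ?_⟩
    · simp only [mul_assoc, he', hf', h₁]
    · simp only [mul_assoc, he', hf', h₂']
  have hxx : x * x = x := by
    calc x * x = f * x * e * (f * x * e) := by rw [h]
      _ = f * x * e := by simp only [mul_assoc, h₂']
      _ = x := h
  have : e * f = x := by rw [← inverse_eq_self hxx, hx, inverse_inverse]
  rw [this, hxx]

/-- Both `e f` and `f e` are inverses of the idempotent `e f`. -/
theorem mul_comm_of_idempotent {e f : S} (he : e * e = e) (hf : f * f = f) :
    e * f = f * e := by
  have he' (a : S) : e * (e * a) = e * a := by rw [← mul_assoc, he]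
  have hf' (a : S) : f * (f * a) = f * a := by rw [← mul_assoc, hf]
  have hef := mul_idempotent he hf
  have hfe := mul_idempotent hf he
  rw [← inverse_eq_self hef]
  symm
  refine eq_inverse ⟨?_, ?_⟩
  · simpa only [mul_assoc, he', hf'] using hef
  · simpa only [mul_assoc, he', hf'] using hfe

theorem mul_inverse_idempotent (s : S) : s * inverse s * (s * inverse s) = s * inverse s := by
  rw [← mul_assoc, mul_inverse_mul]

theorem inverse_mul_idempotent (s : S) : inverse s * s * (inverse s * s) = inverse s * s := by
  rw [← mul_assoc, inverse_mul_inverse]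

theorem inverse_mul (s t : S) : inverse (s * t) = inverse t * inverse s := by
  have h := mul_comm_of_idempotent (mul_inverse_idempotent t) (inverse_mul_idempotent s)
  symm
  refine eq_inverse ⟨?_, ?_⟩
  · calc s * t * (inverse t * inverse s) * (s * t)
        = s * (t * inverse t * (inverse s * s)) * t := by simp only [mul_assoc]
      _ = s * inverse s * s * (t * inverse t * t) := by rw [h]; simp only [mul_assoc]
      _ = s * t := by rw [mul_inverse_mul, mul_inverse_mul]
  · calc inverse t * inverse s * (s * t) * (inverse t * inverse s)
        = inverse t * (inverse s * s * (t * inverse t)) * inverse s := by simp only [mul_assoc]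
      _ = inverse t * t * inverse t * (inverse s * s * inverse s) := by
          rw [← h]; simp only [mul_assoc]
      _ = inverse t * inverse s := by rw [inverse_mul_inverse, inverse_mul_inverse]

end InverseSemigroup

/-! ### From a joint enlargement to an equivalence biset -/

section InversePair

variable {R : Type*} [Semigroup R] {S T : Type*} [Semigroup S] [Semigroup T]

/-- A pair of mutually inverse elements of `R` whose products lie in the images of `φ` and
`ψ`. -/
@[ext]
structure InversePair (φ : S →ₙ* R) (ψ : T →ₙ* R) where
  fst : R
  snd : R
  fst_mul_snd_mul_fst : fst * snd * fst = fst
  snd_mul_fst_mul_snd : snd * fst * snd = snd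
  fst_mul_snd_mem : fst * snd ∈ Set.range φ
  snd_mul_fst_mem : snd * fst ∈ Set.range ψ

/-- An injective homomorphism `φ` is full if `R` is an enlargement of its image. -/
structure IsFullEmbedding (φ : S →ₙ* R) : Prop where
  injective : Function.Injective φ
  mul_mul_mem : ∀ a r b, φ a * r * φ b ∈ Set.range φ
  exists_eq_mul_mul : ∀ r, ∃ p a q, r = p * φ a * q

theorem IsEnlargement.isFullEmbedding {A : Subsemigroup R} (h : IsEnlargement A) (e : S ≃* A) :
    IsFullEmbedding ((MulMemClass.subtype A).comp (e : S →ₙ* A)) where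
  injective _ _ hab := e.injective (Subtype.ext hab)
  mul_mul_mem a r b := by
    have : (e a : R) * r * (e b : R) ∈ (A : Set R) := by
      rw [h.1]
      exact Set.mul_mem_mul (Set.mul_mem_mul (e a).2 (Set.mem_univ r)) (e b).2
    exact ⟨e.symm ⟨_, this⟩, by simp⟩
  exists_eq_mul_mul r := by
    have : r ∈ (Set.univ : Set R) * (A : Set R) * Set.univ := by
      rw [← h.2]; exact Set.mem_univ r
    obtain ⟨_, ⟨p, -, a, ha, rfl⟩, q, -, rfl⟩ := this
    exact ⟨p, e.symm ⟨a, ha⟩, q, by simp⟩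

namespace InversePair

variable {φ : S →ₙ* R} {ψ : T →ₙ* R}

/-- Exchange the two components. -/
@[simps]
def swap (p : InversePair φ ψ) : InversePair ψ φ where
  fst := p.snd
  snd := p.fst
  fst_mul_snd_mul_fst := p.snd_mul_fst_mul_snd
  snd_mul_fst_mul_snd := p.fst_mul_snd_mul_fst
  fst_mul_snd_mem := p.snd_mul_fst_mem
  snd_mul_fst_mem := p.fst_mul_snd_mem

theorem fst_mul_snd_idempotent (p : InversePair φ ψ) :
    p.fst * p.snd * (p.fst * p.snd) = p.fst * p.snd := by
  rw [← mul_assoc, p.fst_mul_snd_mul_fst]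

theorem commute_of_mem_range [IsInverseSemigroup S] (hφ : IsFullEmbedding φ) {a b : R}
    (ha : a ∈ Set.range φ) (hb : b ∈ Set.range φ) (haa : a * a = a) (hbb : b * b = b) :
    a * b = b * a := by
  obtain ⟨s, rfl⟩ := ha
  obtain ⟨t, rfl⟩ := hb
  simp only [← map_mul] at *
  rw [mul_comm_of_idempotent (hφ.injective haa) (hφ.injective hbb)]

/-- From `x = x x' x` and `y' = y' y y'`, `x y' = (x x')(x y')(y y')` is flanked by elements of `S`.
-/
theorem fst_mul_snd_mem_range (hφ : IsFullEmbedding φ) (p q : InversePair φ ψ) :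
    p.fst * q.snd ∈ Set.range φ := by
  obtain ⟨a, ha⟩ := p.fst_mul_snd_mem
  obtain ⟨b, hb⟩ := q.fst_mul_snd_mem
  have := hφ.mul_mul_mem a (p.fst * q.snd) b
  rw [ha, hb] at this
  convert this using 1
  calc p.fst * q.snd = p.fst * p.snd * p.fst * (q.snd * q.fst * q.snd) := by
        rw [p.fst_mul_snd_mul_fst, q.snd_mul_fst_mul_snd]
    _ = _ := by simp only [mul_assoc]

/-- The pairing `⟨(x, x'), (y, y')⟩ = x y'`, as an element of `S`. -/
noncomputable def left (hφ : IsFullEmbedding φ) (p q : InversePair φ ψ) : S :=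
  (fst_mul_snd_mem_range hφ p q).choose

@[simp]
theorem map_left (hφ : IsFullEmbedding φ) (p q : InversePair φ ψ) :
    φ (left hφ p q) = p.fst * q.snd :=
  (fst_mul_snd_mem_range hφ p q).choose_spec

/-- The idempotents `x' x` and `y' y` lie in the image of `T`, so they commute: it is `T` that
controls the pairing into `S`. -/
theorem isInverseOf_left [IsInverseSemigroup T] (hφ : IsFullEmbedding φ)
    (hψ : IsFullEmbedding ψ) (p q : InversePair φ ψ) :
    IsInverseOf (left hφ p q) (left hφ q p) := by
  have key (p q : InversePair φ ψ) :
      left hφ p q * left hφ q p * left hφ p q = left hφ p q := by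
    apply hφ.injective
    simp only [map_mul, map_left]
    have h := commute_of_mem_range hψ q.snd_mul_fst_mem p.snd_mul_fst_mem
      q.swap.fst_mul_snd_idempotent p.swap.fst_mul_snd_idempotent
    calc p.fst * q.snd * (q.fst * p.snd) * (p.fst * q.snd)
          = p.fst * (q.snd * q.fst * (p.snd * p.fst)) * q.snd := by simp only [mul_assoc]
        _ = p.fst * p.snd * p.fst * (q.snd * q.fst * q.snd) := by rw [h]; simp only [mul_assoc]
        _ = _ := by rw [p.fst_mul_snd_mul_fst, q.snd_mul_fst_mul_snd]
  exact ⟨key p q, key q p⟩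

theorem left_swap [IsInverseSemigroup S] [IsInverseSemigroup T] (hφ : IsFullEmbedding φ)
    (hψ : IsFullEmbedding ψ) (p q : InversePair φ ψ) :
    left hφ q p = inverse (left hφ p q) :=
  eq_inverse (isInverseOf_left hφ hψ p q)

/-- The action `s (x, x') = (s x, x' s*)`. -/
@[simps]
noncomputable def act [IsInverseSemigroup S] (hφ : IsFullEmbedding φ) (hψ : IsFullEmbedding ψ)
    (s : S) (p : InversePair φ ψ) : InversePair φ ψ where
  fst := φ s * p.fst
  snd := p.snd * φ (inverse s)
  fst_mul_snd_mul_fst := by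
    have h := commute_of_mem_range hφ p.fst_mul_snd_mem ⟨inverse s * s, rfl⟩
      p.fst_mul_snd_idempotent (by rw [← map_mul, inverse_mul_idempotent])
    rw [map_mul] at h
    calc φ s * p.fst * (p.snd * φ (inverse s)) * (φ s * p.fst)
        = φ s * (p.fst * p.snd * (φ (inverse s) * φ s)) * p.fst := by simp only [mul_assoc]
      _ = φ s * φ (inverse s) * φ s * (p.fst * p.snd * p.fst) := by
          rw [h]; simp only [mul_assoc]
      _ = φ s * p.fst := by
          rw [p.fst_mul_snd_mul_fst, ← map_mul, ← map_mul, mul_inverse_mul]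
  snd_mul_fst_mul_snd := by
    have h := commute_of_mem_range hφ p.fst_mul_snd_mem ⟨inverse s * s, rfl⟩
      p.fst_mul_snd_idempotent (by rw [← map_mul, inverse_mul_idempotent])
    rw [map_mul] at h
    calc p.snd * φ (inverse s) * (φ s * p.fst) * (p.snd * φ (inverse s))
        = p.snd * (φ (inverse s) * φ s * (p.fst * p.snd)) * φ (inverse s) := by
          simp only [mul_assoc]
      _ = p.snd * p.fst * p.snd * (φ (inverse s) * φ s * φ (inverse s)) := by
          rw [← h]; simp only [mul_assoc]
      _ = p.snd * φ (inverse s) := by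
          rw [p.snd_mul_fst_mul_snd, ← map_mul, ← map_mul, inverse_mul_inverse]
  fst_mul_snd_mem := by
    have := hφ.mul_mul_mem s (p.fst * p.snd) (inverse s)
    simpa only [mul_assoc] using this
  snd_mul_fst_mem := by
    obtain ⟨t, ht⟩ := p.snd_mul_fst_mem
    -- Flanking by `x' x = ψ t` changes nothing and lands in the image of `ψ`.
    have := hψ.mul_mul_mem t (p.snd * φ (inverse s) * (φ s * p.fst)) t
    rw [ht] at this
    convert this using 1
    calc p.snd * φ (inverse s) * (φ s * p.fst)
        = p.snd * p.fst * p.snd * φ (inverse s) * (φ s * (p.fst * p.snd * p.fst)) := by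
          rw [p.fst_mul_snd_mul_fst, p.snd_mul_fst_mul_snd]
      _ = _ := by simp only [mul_assoc]

/-- Every idempotent in the image of `φ` is of the form `x x'` for some pair `(x, x')`. -/
theorem exists_fst_mul_snd_eq [IsInverseSemigroup T] (hψ : IsFullEmbedding ψ) {e : S}
    (he : e * e = e) : ∃ p : InversePair φ ψ, p.fst * p.snd = φ e := by
  obtain ⟨p, b, q, h⟩ := hψ.exists_eq_mul_mul (φ e)
  have hee : φ e * φ e = φ e := by rw [← map_mul, he]
  have hb : ψ b * ψ (inverse b) * ψ b = ψ b := by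
    rw [← map_mul, ← map_mul, mul_inverse_mul]
  -- The factorization `e = p b q` through `T` is cut at `b = b (b* b)`. The reversed product `(b* b
  -- q e)(e p b)` is then flanked by elements of `T`.
  have key : φ e * p * ψ b * (ψ (inverse b) * ψ b * q * φ e) = φ e := by
    calc _ = φ e * (p * (ψ b * ψ (inverse b) * ψ b) * q) * φ e := by simp only [mul_assoc]
      _ = φ e := by rw [hb, ← h, hee, hee]
  refine ⟨⟨φ e * p * ψ b, ψ (inverse b) * ψ b * q * φ e, ?_, ?_, ⟨e, key.symm⟩, ?_⟩, key⟩
  · rw [key, ← mul_assoc, ← mul_assoc, hee]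
  · rw [mul_assoc, key, mul_assoc, hee]
  · have := hψ.mul_mul_mem (inverse b * b) (q * φ e * (φ e * p)) b
    simpa only [map_mul, mul_assoc] using this

theorem left_surjective [IsInverseSemigroup S] [IsInverseSemigroup T] (hφ : IsFullEmbedding φ)
    (hψ : IsFullEmbedding ψ) :
    Function.Surjective fun p : InversePair φ ψ × InversePair φ ψ => left hφ p.1 p.2 := by
  intro s
  obtain ⟨p, hp⟩ := exists_fst_mul_snd_eq (φ := φ) hψ (mul_inverse_idempotent s)
  -- With `x x' = s s*`, the second component of `s* (x, x')` is `x' s`, and `x x' s = s`.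
  refine ⟨(p, act hφ hψ (inverse s) p), hφ.injective ?_⟩
  simp only [map_left, act_snd, inverse_inverse]
  rw [← mul_assoc, hp, ← map_mul, mul_inverse_mul]

end InversePair

end InversePair

theorem stronglyMoritaEquivalent_of_isFullEmbedding {R : Type (max u v)} [Semigroup R]
    {S : Type u} {T : Type v} [Semigroup S] [IsInverseSemigroup S] [Semigroup T]
    [IsInverseSemigroup T] {φ : S →ₙ* R} {ψ : T →ₙ* R} (hφ : IsFullEmbedding φ)
    (hψ : IsFullEmbedding ψ) : StronglyMoritaEquivalent S T := by
  let actS : SemigroupAction S (InversePair φ ψ) :=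
    { smul := InversePair.act hφ hψ
      mul_smul := fun s t p => by
        refine InversePair.ext ?_ ?_
        · change φ (s * t) * p.fst = φ s * (φ t * p.fst)
          rw [map_mul, mul_assoc]
        · change p.snd * φ (inverse (s * t)) = p.snd * φ (inverse t) * φ (inverse s)
          rw [inverse_mul, map_mul, mul_assoc] }
  -- By symmetry, `T` acts on swapped pairs. Acting by `t*` there turns the left action into the
  -- right action `(x t, t* x')`.
  let actT : SemigroupAction Tᵐᵒᵖ (InversePair φ ψ) :=
    { smul := fun t p => (InversePair.act hψ hφ (inverse t.unop) p.swap).swap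
      mul_smul := fun s t p => by
        refine InversePair.ext ?_ ?_
        · change p.fst * ψ (inverse (inverse (t.unop * s.unop))) =
            p.fst * ψ (inverse (inverse t.unop)) * ψ (inverse (inverse s.unop))
          simp only [inverse_inverse, map_mul, mul_assoc]
        · change ψ (inverse (t.unop * s.unop)) * p.snd =
            ψ (inverse s.unop) * (ψ (inverse t.unop) * p.snd)
          rw [inverse_mul, map_mul, mul_assoc] }
  have smul_fst (s : S) (p : InversePair φ ψ) : (s • p).fst = φ s * p.fst := rfl
  have smul_snd (s : S) (p : InversePair φ ψ) : (s • p).snd = p.snd * φ (inverse s) := rfl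
  have op_smul_fst (t : T) (p : InversePair φ ψ) : (p <• t).fst = p.fst * ψ t := by
    change p.fst * ψ (inverse (inverse t)) = _
    rw [inverse_inverse]
  have op_smul_snd (t : T) (p : InversePair φ ψ) : (p <• t).snd = ψ (inverse t) * p.snd := rfl
  have comm : SMulCommClass S Tᵐᵒᵖ (InversePair φ ψ) := by
    refine ⟨fun s t p => ?_⟩
    obtain ⟨t, rfl⟩ := MulOpposite.op_surjective t
    refine InversePair.ext ?_ ?_
    · simp only [smul_fst, op_smul_fst, mul_assoc]
    · simp only [smul_snd, op_smul_snd, mul_assoc]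
  refine ⟨InversePair φ ψ, actS, actT, comm, ⟨?_⟩⟩
  exact
    { left := InversePair.left hφ
      right := fun p q => InversePair.left hψ p.swap q.swap
      left_surjective := InversePair.left_surjective hφ hψ
      right_surjective := fun t => by
        obtain ⟨⟨p, q⟩, h⟩ := InversePair.left_surjective hψ hφ t
        exact ⟨(p.swap, q.swap), h⟩
      left_smul := fun s p q => hφ.injective (by
        simp only [map_mul, InversePair.map_left, smul_fst, mul_assoc])
      left_swap := InversePair.left_swap hφ hψ
      left_self_smul := fun p => by
        refine InversePair.ext ?_ ?_
        · rw [smul_fst, InversePair.map_left, p.fst_mul_snd_mul_fst]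
        · rw [smul_snd, ← InversePair.left_swap hφ hψ, InversePair.map_left, ← mul_assoc,
            p.snd_mul_fst_mul_snd]
      right_smul := fun p q t => hψ.injective (by
        simp only [map_mul, InversePair.map_left, InversePair.swap_fst, InversePair.swap_snd,
          op_smul_fst, mul_assoc])
      right_swap := fun p q => InversePair.left_swap hψ hφ q.swap p.swap
      smul_right_self := fun p => by
        refine InversePair.ext ?_ ?_
        · rw [op_smul_fst, InversePair.map_left, InversePair.swap_fst, InversePair.swap_snd,
            ← mul_assoc, p.fst_mul_snd_mul_fst]
        · rw [op_smul_snd, ← InversePair.left_swap hψ hφ, InversePair.map_left,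
            InversePair.swap_fst, InversePair.swap_snd, p.snd_mul_fst_mul_snd]
      left_smul_eq_smul_right := fun p q r => by
        refine InversePair.ext ?_ ?_
        · rw [smul_fst, op_smul_fst, InversePair.map_left, InversePair.map_left,
            InversePair.swap_fst, InversePair.swap_snd, mul_assoc]
        · rw [smul_snd, op_smul_snd, ← InversePair.left_swap hφ hψ,
            ← InversePair.left_swap hψ hφ, InversePair.map_left, InversePair.map_left,
            InversePair.swap_fst, InversePair.swap_snd, mul_assoc] }

/-! ### From an equivalence biset to a joint enlargement -/

namespace EquivalenceBiset

variable {S : Type u} {T : Type v} {X : Type (max u v)}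
  [Semigroup S] [IsInverseSemigroup S] [Semigroup T] [IsInverseSemigroup T]
  [SemigroupAction S X] [SemigroupAction Tᵐᵒᵖ X] [SMulCommClass S Tᵐᵒᵖ X]
  (E : EquivalenceBiset S T X)


theorem left_smul_right (s : S) (x y : X) : E.left x (s • y) = E.left x y * inverse s := by
  rw [E.left_swap, E.left_smul, inverse_mul, ← E.left_swap]

theorem right_smul_left (x y : X) (t : T) : E.right (x <• t) y = inverse t * E.right x y := by
  rw [E.right_swap, E.right_smul, inverse_mul, ← E.right_swap]

/-- Surjectivity lets `t = [u, w]`; both sides then reduce to `⟨x, u⟩⟨w, y⟩` by (M7). -/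
theorem left_op_smul (x y : X) (t : T) : E.left (x <• t) y = E.left x (y <• inverse t) := by
  obtain ⟨⟨u, w⟩, rfl⟩ := E.right_surjective t
  simp only
  rw [← E.right_swap, ← E.left_smul_eq_smul_right, ← E.left_smul_eq_smul_right, E.left_smul,
    E.left_smul_right, ← E.left_swap]

theorem right_smul_smul (s : S) (x y : X) : E.right (s • x) y = E.right x (inverse s • y) := by
  obtain ⟨⟨u, w⟩, rfl⟩ := E.left_surjective s
  simp only
  rw [← E.left_swap, E.left_smul_eq_smul_right, E.left_smul_eq_smul_right, E.right_smul,
    E.right_smul_left, ← E.right_swap]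

/-- The parts of the linking semigroupoid of an equivalence biset: `S`, `X`, the opposite biset
of `X`, and `T`. -/
inductive Linking (S : Type u) (T : Type v) (X : Type (max u v)) :
    Bool → Bool → Type (max u v)
  | ofS : S → Linking S T X true true
  | ofX : X → Linking S T X true false
  | ofXOp : X → Linking S T X false true
  | ofT : T → Linking S T X false false

open Linking

/-- Multiplication of composable elements. -/
noncomputable def comp : {i j k : Bool} → Linking S T X i j → Linking S T X j k →
    Linking S T X i k
  | _, _, _, ofS s, ofS s' => ofS (s * s')
  | _, _, _, ofS s, ofX x => ofX (s • x)
  | _, _, _, ofX x, ofXOp y => ofS (E.left x y)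
  | _, _, _, ofX x, ofT t => ofX (x <• t)
  -- The formal opposite behaves as an inverse `x*`, so `x* s = (s* x)*`.
  | _, _, _, ofXOp x, ofS s => ofXOp (inverse s • x)
  | _, _, _, ofXOp x, ofX y => ofT (E.right x y)
  | _, _, _, ofT t, ofXOp x => ofXOp (x <• inverse t)
  | _, _, _, ofT t, ofT t' => ofT (t * t')

theorem comp_assoc {i j k l : Bool} (a : Linking S T X i j) (b : Linking S T X j k)
    (c : Linking S T X k l) : E.comp (E.comp a b) c = E.comp a (E.comp b c) := by
  cases a <;> cases b <;> cases c <;>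
    simp only [comp, mul_assoc, mul_smul, inverse_mul, MulOpposite.op_mul, E.left_smul,
      E.right_smul, E.left_op_smul, E.right_smul_smul, E.left_smul_right, E.right_smul_left,
      E.left_smul_eq_smul_right, inverse_inverse, smul_comm]
  -- The remaining case is opposite, biset, opposite: once inverses become swapped pairings, it is
  -- (M7).
  rw [← E.right_swap, ← E.left_swap, E.left_smul_eq_smul_right]

/-- Change the left index of an element from `k` to `j`, by means of the element `x`. -/
noncomputable def shift (x : X) {l : Bool} : (j k : Bool) → Linking S T X k l → Linking S T X j l
  | true, true, a => a
  | false, false, a => a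
  | true, false, a => E.comp (ofX x) a
  | false, true, a => E.comp (ofXOp x) a

/-- A shift is at most a left multiplication, so this is associativity of `comp`. It suffices for
associativity of the total product, with no condition on `x`. -/
theorem shift_comp (x : X) {k l m : Bool} (j : Bool) (a : Linking S T X k l)
    (b : Linking S T X l m) : E.shift x j k (E.comp a b) = E.comp (E.shift x j k a) b := by
  cases j <;> cases k <;> simp only [shift, comp_assoc]

/-- The disjoint union of the parts of the linking semigroupoid. -/
@[ext]
structure LinkingSum (E : EquivalenceBiset S T X) (x : X) where
  source : Bool
  target : Bool
  val : Linking S T X source target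

namespace LinkingSum

variable {E} {x : X}

/-- The product depends on the inserted element, hence `x` is a parameter of the type. -/
noncomputable instance : Mul (LinkingSum E x) where
  mul a b := ⟨a.source, b.target, E.comp a.val (E.shift x a.target b.source b.val)⟩

theorem mk_mul_mk {i j k l : Bool} (a : Linking S T X i j) (b : Linking S T X k l) :
    (⟨i, j, a⟩ * ⟨k, l, b⟩ : LinkingSum E x) = ⟨i, l, E.comp a (E.shift x j k b)⟩ := rfl

noncomputable instance : Semigroup (LinkingSum E x) where
  mul_assoc := by
    rintro ⟨i, j, a⟩ ⟨k, l, b⟩ ⟨m, n, c⟩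
    simp only [mk_mul_mk, shift_comp, comp_assoc]

theorem mk_mul_mk_self {i j k : Bool} (a : Linking S T X i j) (b : Linking S T X j k) :
    (⟨i, j, a⟩ * ⟨j, k, b⟩ : LinkingSum E x) = ⟨i, k, E.comp a b⟩ := by
  cases j <;> rfl

/-- Composable products do not involve `x`, so inverses can be found in the semigroupoid; `y` and
its formal opposite are mutually inverse by (M3) and (M6). -/
theorem isRegularSemigroup : IsRegularSemigroup (LinkingSum E x) := by
  rintro ⟨i, j, a⟩
  cases a with
  | ofS s =>
    refine ⟨⟨_, _, ofS (inverse s)⟩, ?_, ?_⟩ <;>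
      simp only [mk_mul_mk_self, comp, mul_inverse_mul, inverse_mul_inverse]
  | ofX y =>
    refine ⟨⟨_, _, ofXOp y⟩, ?_, ?_⟩ <;>
      simp only [mk_mul_mk_self, comp, E.left_self_smul, ← E.right_swap, E.smul_right_self]
  | ofXOp y =>
    refine ⟨⟨_, _, ofX y⟩, ?_, ?_⟩ <;>
      simp only [mk_mul_mk_self, comp, E.left_self_smul, ← E.right_swap, E.smul_right_self]
  | ofT t =>
    refine ⟨⟨_, _, ofT (inverse t)⟩, ?_, ?_⟩ <;>
      simp only [mk_mul_mk_self, comp, mul_inverse_mul, inverse_mul_inverse]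

/-- The embedding of `S`. -/
noncomputable def inl (E : EquivalenceBiset S T X) (x : X) : S →ₙ* LinkingSum E x where
  toFun s := ⟨_, _, ofS s⟩
  map_mul' _ _ := rfl

theorem inl_apply (s : S) : inl E x s = ⟨_, _, ofS s⟩ := rfl

/-- The embedding of `T`. -/
noncomputable def inr (E : EquivalenceBiset S T X) (x : X) : T →ₙ* LinkingSum E x where
  toFun t := ⟨_, _, ofT t⟩
  map_mul' _ _ := rfl

theorem inr_apply (t : T) : inr E x t = ⟨_, _, ofT t⟩ := rfl

theorem isFullEmbedding_inl : IsFullEmbedding (inl E x) where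
  injective s s' h := by
    simpa only [inl_apply, LinkingSum.mk.injEq, heq_eq_eq, true_and,
      Linking.ofS.injEq] using h
  mul_mul_mem s r s' := by
    -- Only the outer indices of a product matter: `s r s'` has both equal to `true`, and that
    -- corner is `S`.
    have (c : Linking S T X true true) :
        (⟨true, true, c⟩ : LinkingSum E x) ∈ Set.range (inl E x) := by
      cases c with
      | ofS s => exact ⟨s, rfl⟩
    exact this _
  exists_eq_mul_mul r := by
    obtain ⟨i, j, a⟩ := r
    cases a with
    | ofS s =>
      refine ⟨⟨_, _, ofS s⟩, inverse s, ⟨_, _, ofS s⟩, ?_⟩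
      simp only [inl_apply, mk_mul_mk_self, comp, mul_inverse_mul]
    | ofX y =>
      refine ⟨⟨_, _, ofS (E.left y y)⟩, E.left y y, ⟨_, _, ofX y⟩, ?_⟩
      simp only [inl_apply, mk_mul_mk_self, comp, mul_smul, E.left_self_smul]
    | ofXOp y =>
      refine ⟨⟨_, _, ofXOp y⟩, E.left y y, ⟨_, _, ofS (E.left y y)⟩, ?_⟩
      simp only [inl_apply, mk_mul_mk_self, comp, ← E.left_swap, E.left_self_smul]
    | ofT t =>
      -- Surjectivity writes `t = [y, z]`, which factors through `S` as `y* ⟨y, y⟩ z`.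
      obtain ⟨⟨y, z⟩, rfl⟩ := E.right_surjective t
      refine ⟨⟨_, _, ofXOp y⟩, E.left y y, ⟨_, _, ofX z⟩, ?_⟩
      simp only [inl_apply, mk_mul_mk_self, comp, ← E.left_swap, E.left_self_smul]

theorem isFullEmbedding_inr : IsFullEmbedding (inr E x) where
  injective s s' h := by
    simpa only [inr_apply, LinkingSum.mk.injEq, heq_eq_eq, true_and,
      Linking.ofT.injEq] using h
  mul_mul_mem s r s' := by
    have (c : Linking S T X false false) :
        (⟨false, false, c⟩ : LinkingSum E x) ∈ Set.range (inr E x) := by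
      cases c with
      | ofT t => exact ⟨t, rfl⟩
    exact this _
  exists_eq_mul_mul r := by
    obtain ⟨i, j, a⟩ := r
    cases a with
    | ofS s =>
      obtain ⟨⟨y, z⟩, rfl⟩ := E.left_surjective s
      refine ⟨⟨_, _, ofX y⟩, E.right y y, ⟨_, _, ofXOp z⟩, ?_⟩
      simp only [inr_apply, mk_mul_mk_self, comp, E.smul_right_self]
    | ofX y =>
      refine ⟨⟨_, _, ofX y⟩, E.right y y, ⟨_, _, ofT (E.right y y)⟩, ?_⟩
      simp only [inr_apply, mk_mul_mk_self, comp, E.smul_right_self]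
    | ofXOp y =>
      refine ⟨⟨_, _, ofT (E.right y y)⟩, E.right y y, ⟨_, _, ofXOp y⟩, ?_⟩
      simp only [inr_apply, mk_mul_mk_self, comp, inverse_mul, MulOpposite.op_mul, mul_smul,
        ← E.right_swap, E.smul_right_self]
    | ofT t =>
      refine ⟨⟨_, _, ofT t⟩, inverse t, ⟨_, _, ofT t⟩, ?_⟩
      simp only [inr_apply, mk_mul_mk_self, comp, mul_inverse_mul]

end LinkingSum

end EquivalenceBiset

/-! ### Full embeddings as enlargements, and the theorem. -/

theorem IsFullEmbedding.isEnlargement_srange {R S : Type*} [Semigroup R] [Semigroup S]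
    [IsInverseSemigroup S] {φ : S →ₙ* R} (hφ : IsFullEmbedding φ) : IsEnlargement φ.srange := by
  constructor
  · refine Set.Subset.antisymm ?_ ?_
    · rintro _ ⟨s, rfl⟩
      refine ⟨_, ⟨φ s, ⟨s, rfl⟩, φ (inverse s), Set.mem_univ _, rfl⟩, φ s, ⟨s, rfl⟩, ?_⟩
      simp only [← map_mul, mul_inverse_mul]
    · rintro _ ⟨_, ⟨_, ⟨s, rfl⟩, r, -, rfl⟩, _, ⟨s', rfl⟩, rfl⟩
      exact hφ.mul_mul_mem s r s'
  · refine (Set.eq_univ_of_forall fun r => ?_).symm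
    obtain ⟨p, a, q, rfl⟩ := hφ.exists_eq_mul_mul r
    exact Set.mul_mem_mul (Set.mul_mem_mul (Set.mem_univ p) ⟨a, rfl⟩) (Set.mem_univ q)

theorem IsFullEmbedding.nonempty_mulEquiv_srange {R S : Type*} [Semigroup R] [Semigroup S]
    {φ : S →ₙ* R} (hφ : IsFullEmbedding φ) : Nonempty (S ≃* φ.srange) :=
  ⟨MulEquiv.ofBijective φ.srangeRestrict
    ⟨fun _ _ h => hφ.injective (congrArg Subtype.val h), φ.srangeRestrict_surjective⟩⟩

theorem isJointEnlargement_of_isFullEmbedding {R : Type (max u v)} [Semigroup R]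
    {S : Type u} {T : Type v} [Semigroup S] [IsInverseSemigroup S] [Semigroup T]
    [IsInverseSemigroup T] {φ : S →ₙ* R} {ψ : T →ₙ* R} (hφ : IsFullEmbedding φ)
    (hψ : IsFullEmbedding ψ) : IsJointEnlargement R S T :=
  ⟨φ.srange, ψ.srange, hφ.nonempty_mulEquiv_srange, hψ.nonempty_mulEquiv_srange,
    hφ.isEnlargement_srange, hψ.isEnlargement_srange⟩

theorem StronglyMoritaEquivalent.exists_isJointEnlargement {S : Type u} {T : Type v}
    [Semigroup S] [IsInverseSemigroup S] [Semigroup T] [IsInverseSemigroup T]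
    (h : StronglyMoritaEquivalent S T) :
    ∃ (R : Type (max u v)) (_ : Semigroup R),
      IsRegularSemigroup R ∧ IsJointEnlargement R S T := by
  obtain ⟨X, _, _, _, ⟨E⟩⟩ := h
  -- If `X` is empty there is no `x` to insert, but surjectivity of the pairings makes `S` and `T`
  -- empty, and the empty semigroup serves as `R`.
  obtain hX | ⟨⟨x⟩⟩ := isEmpty_or_nonempty X
  · have hS : IsEmpty S := ⟨fun s => hX.elim (E.left_surjective s).choose.1⟩
    have hT : IsEmpty T := ⟨fun t => hX.elim (E.right_surjective t).choose.1⟩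
    let _ : Semigroup PEmpty.{max u v + 1} := { mul := fun a _ => a, mul_assoc := nofun }
    let φ : S →ₙ* PEmpty.{max u v + 1} := ⟨hS.elim, fun s => hS.elim s⟩
    let ψ : T →ₙ* PEmpty.{max u v + 1} := ⟨hT.elim, fun t => hT.elim t⟩
    exact ⟨PEmpty, inferInstance, nofun, isJointEnlargement_of_isFullEmbedding (φ := φ) (ψ := ψ)
      ⟨fun s => hS.elim s, fun s => hS.elim s, nofun⟩
      ⟨fun t => hT.elim t, fun t => hT.elim t, nofun⟩⟩
  · exact ⟨E.LinkingSum x, inferInstance, EquivalenceBiset.LinkingSum.isRegularSemigroup,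
      isJointEnlargement_of_isFullEmbedding EquivalenceBiset.LinkingSum.isFullEmbedding_inl
        EquivalenceBiset.LinkingSum.isFullEmbedding_inr⟩

theorem IsJointEnlargement.stronglyMoritaEquivalent {R : Type (max u v)} [Semigroup R]
    {S : Type u} {T : Type v} [Semigroup S] [IsInverseSemigroup S] [Semigroup T]
    [IsInverseSemigroup T] (h : IsJointEnlargement R S T) : StronglyMoritaEquivalent S T := by
  obtain ⟨A, B, ⟨e⟩, ⟨f⟩, hA, hB⟩ := h
  exact stronglyMoritaEquivalent_of_isFullEmbedding (hA.isFullEmbedding e) (hB.isFullEmbedding f)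

end SemigroupMorita

theorem mainTheorem7 (S : Type u) (T : Type v)
    [Semigroup S] [SemigroupMorita.IsInverseSemigroup S]
    [Semigroup T] [SemigroupMorita.IsInverseSemigroup T] :
    SemigroupMorita.StronglyMoritaEquivalent S T ↔
      ∃ (R : Type (max u v)) (_ : Semigroup R),
        SemigroupMorita.IsRegularSemigroup R ∧ SemigroupMorita.IsJointEnlargement R S T := by
  refine ⟨fun h => h.exists_isJointEnlargement, ?_⟩
  rintro ⟨R, _, -, h⟩
  exact h.stronglyMoritaEquivalent
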